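/- For every real number $\alpha>0$ there exist real numbers $\beta=\beta(\alpha)>0$ and $C=C(\alpha)>0$ such that the following holds. Let $p$ be a prime, let $T$ be a natural number, let $g\in\mathbb{F}_p^\times$ have multiplicative order at least $T$, and let $H=\{g^t : 0\le t<T\}$ (so that $|H|=T$). If $T>p^\alpha$, then for every non-trivial additive character $\psi:\mathbb{F}_p\to\mathbb{C}$, $$\Bigl|\sum_{x\in H}\psi(x)\Bigr|\le C\,p^{-\beta}\,|H| .$$ -/

import Mathlib

/-- The segment `{g ^ t : 0 ≤ t < T}` of the cyclic group generated by a unit `g` of `𝔽_p`,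
as a finite subset of `𝔽_p`. -/
def powerSegment {p : ℕ} (g : (ZMod p)ˣ) (T : ℕ) : Finset (ZMod p) :=
  (Finset.range T).image (fun t : ℕ => (g : ZMod p) ^ t)

section

open Finset Pointwise ComplexConjugate

/-! The argument is of Bourgain–Glibichuk–Konyagin type. Put `K = p ^ ε` with `ε` small, suppose the
sum is large, and let `Λ j` be the set of frequencies where the normalized sum is at least `τ j`,
with `τ (j + 1) = τ j ^ 2 / 2`. Two facts link consecutive levels. By Cauchy–Schwarz, a proportion
at least `τ (j + 1)` of the differences of `Λ j` lie in `Λ (j + 1)`. And since multiplying the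
frequency by `g ^ s` only shifts the window of exponents, `g ^ s • Λ j ⊆ Λ (j + 1)` for `s ≤ T / K ^
3`.

All levels have size between `1` and `p ≤ K ^ J`, so some step has `#(Λ (j + 1)) ≤ K * #(Λ j)`.
There `balog_szemeredi_gowers` yields a large `B ⊆ Λ j` with few differences, and the many dilates
of `B` inside `Λ (j + 1)` must overlap. So `B + x • B` is small for many ratios `x`
(`exists_many_controlled`).

Such `x` are stable under ring operations, at a polynomial cost in the constant, so by sum-product
growth (`exists_controlled_growth_iterate`) they come to fill a positive proportion of `𝔽_p`. But
for some nonzero `x` among so many, `B + x • B` is large (`exists_dilate_card_add_ge`). Hence `Λ j`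
is either tiny, although `Λ (j + 1)` contains a long segment of powers of `g`, or of size nearly
`p`, which Parseval forbids. -/

/-! ### Balog–Szemerédi–Gowers -/

/-- Dependent random choice: `B` is the neighbourhood of a well-chosen vertex `b`. A pair with few
common neighbours lies in few neighbourhoods, so such pairs are rare on average. -/
theorem exists_subset_few_bad_pairs {α : Type*} [DecidableEq α] (A : Finset α) (r : α → α → Prop)
    [DecidableRel r] {K : ℝ} (hK : 1 ≤ K) (hA : A.Nonempty)
    (hE : (#A : ℝ) ^ 2 / K ≤ #{x ∈ A ×ˢ A | r x.1 x.2}) :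
    ∃ B ⊆ A, (#A : ℝ) / (2 * K) ≤ #B ∧
      (#{x ∈ B ×ˢ B | (#{b ∈ A | r x.1 b ∧ r x.2 b} : ℝ) < #A / (16 * K ^ 2)} : ℝ)
        ≤ (#B : ℝ) ^ 2 / 8 := by
  classical
  set n : ℝ := (#A : ℝ) with hn
  have hn0 : 0 < n := by rw [hn]; exact_mod_cast hA.card_pos
  have hK0 : 0 < K := by linarith
  let N : α → Finset α := fun b => {a ∈ A | r a b}
  let bad : α × α → Prop := fun x => (#{b ∈ A | r x.1 b ∧ r x.2 b} : ℝ) < n / (16 * K ^ 2)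
  have h1 : ∑ b ∈ A, (#(N b) : ℝ) = #{x ∈ A ×ˢ A | r x.1 x.2} := by
    simp only [N, Finset.card_filter, Finset.sum_product]
    push_cast
    rw [Finset.sum_comm]
  have h2 : n ^ 3 / K ^ 2 ≤ ∑ b ∈ A, (#(N b) : ℝ) ^ 2 := by
    have hcs := sq_sum_le_card_mul_sum_sq (s := A) (f := fun b => (#(N b) : ℝ))
    rw [h1] at hcs
    have h3 : (n ^ 2 / K) ^ 2 ≤ n * ∑ b ∈ A, (#(N b) : ℝ) ^ 2 :=
      le_trans (by gcongr) hcs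
    have h4 : n * (n ^ 3 / K ^ 2) = (n ^ 2 / K) ^ 2 := by field_simp
    rw [← h4] at h3
    exact le_of_mul_le_mul_left h3 hn0
  have h3 : ∑ b ∈ A, (#{x ∈ N b ×ˢ N b | bad x} : ℝ) ≤ n ^ 3 / (16 * K ^ 2) := by
    have e : ∑ b ∈ A, (#{x ∈ N b ×ˢ N b | bad x} : ℝ)
        = ∑ x ∈ A ×ˢ A with bad x, (#{b ∈ A | r x.1 b ∧ r x.2 b} : ℝ) := by
      have : ∀ b ∈ A, (#{x ∈ N b ×ˢ N b | bad x} : ℝ)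
          = ∑ x ∈ A ×ˢ A with bad x, if r x.1 b ∧ r x.2 b then (1 : ℝ) else 0 := by
        intro b _
        rw [← Finset.sum_filter, Finset.sum_const, nsmul_eq_mul, mul_one]
        congr 2
        ext x
        simp only [N, mem_filter, mem_product]
        tauto
      rw [Finset.sum_congr rfl this, Finset.sum_comm]
      refine Finset.sum_congr rfl fun x _ => ?_
      rw [← Finset.sum_filter, Finset.sum_const, nsmul_eq_mul, mul_one]
    rw [e]
    calc _ ≤ ∑ x ∈ A ×ˢ A with bad x, n / (16 * K ^ 2) :=
          Finset.sum_le_sum fun x hx => (mem_filter.1 hx).2.le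
      _ ≤ n ^ 2 * (n / (16 * K ^ 2)) := by
          rw [Finset.sum_const, nsmul_eq_mul]
          have : (#{x ∈ A ×ˢ A | bad x} : ℝ) ≤ n ^ 2 := by
            have h : #{x ∈ A ×ˢ A | bad x} ≤ #A ^ 2 :=
              (card_filter_le _ _).trans (by rw [card_product, sq])
            exact (Nat.cast_le.2 h).trans (Nat.cast_pow _ _).le
          gcongr
      _ = _ := by ring
  -- The weight `8` lets a single average give both conclusions: the left side being positive bounds
  -- the bad pairs, and dropping them bounds `#(N b)` below.
  obtain ⟨b, hb, hb'⟩ : ∃ b ∈ A, n ^ 2 / (2 * K ^ 2)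
      ≤ (#(N b) : ℝ) ^ 2 - 8 * #{x ∈ N b ×ˢ N b | bad x} := by
    apply Finset.exists_le_of_sum_le hA
    rw [Finset.sum_const, nsmul_eq_mul, Finset.sum_sub_distrib, ← Finset.mul_sum]
    have : n * (n ^ 2 / (2 * K ^ 2)) = n ^ 3 / K ^ 2 - 8 * (n ^ 3 / (16 * K ^ 2)) := by
      field_simp; ring
    rw [← hn, this]
    linarith
  have hbad : (0 : ℝ) ≤ #{x ∈ N b ×ˢ N b | bad x} := by positivity
  refine ⟨N b, filter_subset _ _, ?_, ?_⟩
  · refine (pow_le_pow_iff_left₀ (by positivity) (by positivity) two_ne_zero).1 ?_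
    have : (n / (2 * K)) ^ 2 ≤ n ^ 2 / (2 * K ^ 2) := by
      rw [div_pow, mul_pow]; gcongr; norm_num
    linarith
  · have : 0 ≤ n ^ 2 / (2 * K ^ 2) := by positivity
    linarith

/-- Keep the vertices that are bad with at most a quarter of `B`. Any two of them share at least `#B
/ 2` good partners `c`, and each such `c` gives many paths of length four through it. -/
theorem exists_subset_many_paths {α : Type*} [DecidableEq α] (A : Finset α) (r : α → α → Prop)
    [DecidableRel r] {K : ℝ} (hK : 1 ≤ K) (hA : A.Nonempty)
    (hE : (#A : ℝ) ^ 2 / K ≤ #{x ∈ A ×ˢ A | r x.1 x.2}) :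
    ∃ B ⊆ A, (#A : ℝ) / (4 * K) ≤ #B ∧ ∀ a ∈ B, ∀ a' ∈ B, (#A : ℝ) ^ 3 / (1024 * K ^ 5) ≤
      #{x ∈ A ×ˢ A ×ˢ A | r a x.2.1 ∧ r x.1 x.2.1 ∧ r x.1 x.2.2 ∧ r a' x.2.2} := by
  classical
  obtain ⟨B, hBA, hB, hbad⟩ := exists_subset_few_bad_pairs A r hK hA hE
  set n : ℝ := (#A : ℝ) with hn
  have hn0 : 0 < n := by rw [hn]; exact_mod_cast hA.card_pos
  have hK0 : 0 < K := by linarith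
  let bad : α → α → Prop := fun a a' => (#{b ∈ A | r a b ∧ r a' b} : ℝ) < n / (16 * K ^ 2)
  have hB0 : (0 : ℝ) < #B := lt_of_lt_of_le (by positivity) hB
  let B' : Finset α := {a ∈ B | (#{a' ∈ B | bad a a'} : ℝ) ≤ #B / 4}
  have hcompl : (#{a ∈ B | ¬ (#{a' ∈ B | bad a a'} : ℝ) ≤ #B / 4} : ℝ) ≤ #B / 2 := by
    have h1 : ∑ a ∈ B with ¬ (#{a' ∈ B | bad a a'} : ℝ) ≤ #B / 4, (#B / 4 : ℝ)
        ≤ ∑ a ∈ B, (#{a' ∈ B | bad a a'} : ℝ) :=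
      (Finset.sum_le_sum fun a ha => (not_le.1 (mem_filter.1 ha).2).le).trans
        (Finset.sum_le_sum_of_subset_of_nonneg (filter_subset _ _) fun _ _ _ => by positivity)
    have h2 : ∑ a ∈ B, (#{a' ∈ B | bad a a'} : ℝ) = #{x ∈ B ×ˢ B | bad x.1 x.2} := by
      simp only [Finset.card_filter, Finset.sum_product]
      push_cast
      rfl
    rw [h2, Finset.sum_const, nsmul_eq_mul] at h1
    have h3 := h1.trans hbad
    rw [show (#B : ℝ) ^ 2 / 8 = (#B / 2) * (#B / 4) by ring] at h3
    exact le_of_mul_le_mul_right h3 (by positivity)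
  have hB' : (#B : ℝ) / 2 ≤ #B' := by
    have := Finset.card_filter_add_card_filter_not (s := B)
      (fun a => (#{a' ∈ B | bad a a'} : ℝ) ≤ #B / 4)
    have h : (#B' : ℝ) + #{a ∈ B | ¬ (#{a' ∈ B | bad a a'} : ℝ) ≤ #B / 4} = #B := by
      exact_mod_cast this
    linarith
  refine ⟨B', (filter_subset _ _).trans hBA, ?_, ?_⟩
  · have : n / (4 * K) = n / (2 * K) / 2 := by field_simp; norm_num
    linarith
  intro a ha a' ha'
  have hgood : (#B : ℝ) / 2 ≤ #{c ∈ B | ¬ bad a c ∧ ¬ bad a' c} := by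
    have h1 : (#B : ℝ) ≤ #{c ∈ B | ¬ bad a c ∧ ¬ bad a' c}
        + (#{c ∈ B | bad a c} + #{c ∈ B | bad a' c}) := by
      have : B ⊆ {c ∈ B | ¬ bad a c ∧ ¬ bad a' c} ∪ ({c ∈ B | bad a c} ∪ {c ∈ B | bad a' c}) := by
        intro c hc
        simp only [mem_union, mem_filter, hc, true_and]
        tauto
      exact_mod_cast (card_le_card this).trans ((card_union_le _ _).trans
        (Nat.add_le_add_left (card_union_le _ _) _))
    have h2 := (mem_filter.1 ha).2
    have h3 := (mem_filter.1 ha').2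
    linarith
  have hcount : (#{x ∈ A ×ˢ A ×ˢ A | r a x.2.1 ∧ r x.1 x.2.1 ∧ r x.1 x.2.2 ∧ r a' x.2.2} : ℝ)
      = ∑ c ∈ A, (#{b ∈ A | r a b ∧ r c b} : ℝ) * #{b ∈ A | r a' b ∧ r c b} := by
    rw [Finset.card_filter, Finset.sum_product]
    push_cast
    refine Finset.sum_congr rfl fun c _ => ?_
    rw [← Nat.cast_mul, ← card_product, ← Finset.filter_product,
      ← Finset.sum_filter, Finset.sum_const, nsmul_eq_mul, mul_one]
    congr 2
    ext x
    simp only [mem_filter]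
    tauto
  rw [hcount]
  calc n ^ 3 / (1024 * K ^ 5) = (n / (2 * K) / 2) * (n / (16 * K ^ 2) * (n / (16 * K ^ 2))) := by
        field_simp; norm_num
    _ ≤ (#{c ∈ B | ¬ bad a c ∧ ¬ bad a' c} : ℝ) * (n / (16 * K ^ 2) * (n / (16 * K ^ 2))) := by
        gcongr; linarith
    _ = ∑ c ∈ B with ¬ bad a c ∧ ¬ bad a' c, (n / (16 * K ^ 2) * (n / (16 * K ^ 2))) := by
        rw [Finset.sum_const, nsmul_eq_mul]
    _ ≤ ∑ c ∈ B with ¬ bad a c ∧ ¬ bad a' c,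
          (#{b ∈ A | r a b ∧ r c b} : ℝ) * #{b ∈ A | r a' b ∧ r c b} := by
        refine Finset.sum_le_sum fun c hc => ?_
        have h := (mem_filter.1 hc).2
        exact mul_le_mul (not_lt.1 h.1) (not_lt.1 h.2) (by positivity) (by positivity)
    _ ≤ _ := Finset.sum_le_sum_of_subset_of_nonneg ((filter_subset _ _).trans hBA)
        fun _ _ _ => by positivity

/-- A **Balog–Szemerédi–Gowers** theorem for differences. -/
theorem balog_szemeredi_gowers {G : Type*} [AddCommGroup G] [DecidableEq G] (A D : Finset G)
    {K : ℝ} (hK : 1 ≤ K) (hA : A.Nonempty) (hD : (#D : ℝ) ≤ K * #A)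
    (hE : (#A : ℝ) ^ 2 / K ≤ #{x ∈ A ×ˢ A | x.1 - x.2 ∈ D}) :
    ∃ B ⊆ A, (#A : ℝ) / (4 * K) ≤ #B ∧ (#(B - B) : ℝ) ≤ 4096 * K ^ 10 * #B := by
  classical
  obtain ⟨B, hBA, hB, hpath⟩ := exists_subset_many_paths A (fun a b => a - b ∈ D) hK hA hE
  refine ⟨B, hBA, hB, ?_⟩
  set n : ℝ := (#A : ℝ) with hn
  have hn0 : 0 < n := by rw [hn]; exact_mod_cast hA.card_pos
  have hK0 : 0 < K := by linarith
  -- A path `a, b, c, b', a'` writes `a - a' = (a - b) - (c - b) + (c - b') - (a' - b')` with all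
  -- four terms in `D`.
  have hfib : ∀ d ∈ B - B, n ^ 3 / (1024 * K ^ 5) ≤
      #{y ∈ D ×ˢ D ×ˢ D ×ˢ D | y.1 - y.2.1 + y.2.2.1 - y.2.2.2 = d} := by
    intro d hd
    obtain ⟨a, ha, a', ha', rfl⟩ := mem_sub.1 hd
    refine (hpath a ha a' ha').trans (Nat.cast_le.2 ?_)
    refine card_le_card_of_injOn
      (fun x => (a - x.2.1, x.1 - x.2.1, x.1 - x.2.2, a' - x.2.2)) ?_ ?_
    · intro x hx
      have hx := (mem_filter.1 hx).2
      refine mem_coe.2 (mem_filter.2 ⟨?_, by simp only; abel⟩)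
      simp only [mem_product]
      exact hx
    · rintro ⟨x, y, z⟩ _ ⟨x', y', z'⟩ _ h
      simp only [Prod.mk.injEq, sub_right_inj] at h
      obtain ⟨rfl, h2, -, rfl⟩ := h
      simpa using h2
  have hsum : ∑ d ∈ B - B, (#{y ∈ D ×ˢ D ×ˢ D ×ˢ D | y.1 - y.2.1 + y.2.2.1 - y.2.2.2 = d} : ℝ)
      ≤ (#D : ℝ) ^ 4 := by
    have h := Finset.card_eq_sum_card_fiberwise
      (s := {y ∈ D ×ˢ D ×ˢ D ×ˢ D | y.1 - y.2.1 + y.2.2.1 - y.2.2.2 ∈ B - B})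
      (t := B - B) (f := fun y => y.1 - y.2.1 + y.2.2.1 - y.2.2.2)
      (fun y hy => (mem_filter.1 hy).2)
    have h' := (card_filter_le (D ×ˢ D ×ˢ D ×ˢ D)
      (fun y => y.1 - y.2.1 + y.2.2.1 - y.2.2.2 ∈ B - B))
    rw [h] at h'
    simp only [card_product] at h'
    have e : ∀ d ∈ B - B, #{y ∈ D ×ˢ D ×ˢ D ×ˢ D | y.1 - y.2.1 + y.2.2.1 - y.2.2.2 = d}
        = #{y ∈ {y ∈ D ×ˢ D ×ˢ D ×ˢ D | y.1 - y.2.1 + y.2.2.1 - y.2.2.2 ∈ B - B} |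
            y.1 - y.2.1 + y.2.2.1 - y.2.2.2 = d} := by
      intro d hd
      congr 1
      ext y
      simp only [mem_filter, and_assoc]
      refine and_congr_right fun _ => ⟨fun h => ⟨h ▸ hd, h⟩, fun h => h.2⟩
    calc _ = ((∑ d ∈ B - B,
          #{y ∈ D ×ˢ D ×ˢ D ×ˢ D | y.1 - y.2.1 + y.2.2.1 - y.2.2.2 = d} : ℕ) : ℝ) := by push_cast; rfl
      _ ≤ ((#D * (#D * (#D * #D)) : ℕ) : ℝ) := by
          rw [Finset.sum_congr rfl e]; exact_mod_cast h'
      _ = _ := by push_cast; ring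
  have h1 : (#(B - B) : ℝ) * (n ^ 3 / (1024 * K ^ 5)) ≤ (K * n) ^ 4 := by
    calc _ = ∑ d ∈ B - B, n ^ 3 / (1024 * K ^ 5) := by rw [Finset.sum_const, nsmul_eq_mul]
      _ ≤ _ := (Finset.sum_le_sum hfib).trans hsum
      _ ≤ _ := by gcongr
  have h2 : n ≤ 4 * K * #B := by
    rw [div_le_iff₀ (by positivity)] at hB; linarith
  have h3 : (#(B - B) : ℝ) ≤ 1024 * K ^ 9 * n := by
    rw [mul_div_assoc', div_le_iff₀ (by positivity)] at h1
    have : (0 : ℝ) < n ^ 3 := by positivity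
    refine le_of_mul_le_mul_right ?_ this
    linarith
  calc _ ≤ _ := h3
    _ ≤ 1024 * K ^ 9 * (4 * K * #B) := by gcongr
    _ = _ := by ring

/-! ### Arithmetic of controlled dilates -/

/-- `x` is `L`-controlled by `A` if the sumset of `A` with its dilate by `x` has size
at most `L * #A`. -/
def IsDilateControlled {F : Type*} [Field F] [DecidableEq F] (A : Finset F) (L : ℝ)
    (x : F) : Prop :=
  (#(A + x • A) : ℝ) ≤ L * #A

namespace IsDilateControlled
variable {F : Type*} [Field F] [DecidableEq F] {A : Finset F} {L M : ℝ} {x y : F}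

theorem mono (h : IsDilateControlled A L x) (hLM : L ≤ M) : IsDilateControlled A M x :=
  le_trans h (by gcongr)

theorem zero (hL : 1 ≤ L) : IsDilateControlled A L (0 : F) := by
  have h : #(A + (0 : F) • A) ≤ #A := by
    rcases A.eq_empty_or_nonempty with rfl | hA
    · simp
    · rw [zero_smul_finset hA]; simp
  have h' : (#(A + (0 : F) • A) : ℝ) ≤ #A := by exact_mod_cast h
  have : (0 : ℝ) ≤ #A := by positivity
  unfold IsDilateControlled
  nlinarith

theorem card_nsmul_sub_nsmul_le (hA : A.Nonempty) (hAA : (#(A - A) : ℝ) ≤ L * #A) (m n : ℕ) :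
    (#(m • A - n • A) : ℝ) ≤ L ^ (m + n) * #A := by
  have h := pluennecke_ruzsa_inequality_nsmul_sub_nsmul_sub hA A m n
  have h' : (#(m • A - n • A) : ℝ) ≤ (#(A - A) / #A : ℝ) ^ (m + n) * #A := by
    have := (NNRat.cast_le (K := ℝ)).2 h
    push_cast at this
    exact this
  refine h'.trans ?_
  have : (0 : ℝ) < #A := by exact_mod_cast hA.card_pos
  gcongr
  rwa [div_le_iff₀ this]

/-- Ruzsa's triangle inequality through the intermediate set `x • A`. -/
theorem mul (hA : A.Nonempty) (hL : 1 ≤ L) (hx : IsDilateControlled A L x)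
    (hy : IsDilateControlled A L y) : IsDilateControlled A (L ^ 2) (x * y) := by
  rcases eq_or_ne x 0 with rfl | hx0
  · rw [zero_mul]; exact zero (one_le_pow₀ hL)
  have h := ruzsa_triangle_inequality_add_add_add A (x • A) ((x * y) • A)
  rw [mul_smul, ← smul_add x A, card_smul_finset₀ hx0, card_smul_finset₀ hx0] at h
  have h' : (#(A + x • y • A) : ℝ) * #A ≤ #(A + x • A) * #(A + y • A) := by exact_mod_cast h
  have hA0 : (0 : ℝ) < #A := by exact_mod_cast hA.card_pos
  unfold IsDilateControlled at *
  rw [mul_smul]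
  refine le_of_mul_le_mul_right (h'.trans ?_) hA0
  calc _ ≤ (L * #A) * (L * #A) := by gcongr
    _ = _ := by ring

theorem neg (hA : A.Nonempty) (hAA : (#(A - A) : ℝ) ≤ L * #A) (hL : 1 ≤ L)
    (hx : IsDilateControlled A L x) : IsDilateControlled A (L ^ 3) (-x) := by
  have h := ruzsa_triangle_inequality_sub_add_add A A (x • A)
  have h' : (#(A - x • A) : ℝ) * #A ≤ #(A + A) * #(A + x • A) := by
    rw [add_comm A (x • A)]; exact_mod_cast h
  have hA0 : (0 : ℝ) < #A := by exact_mod_cast hA.card_pos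
  have h2 := card_nsmul_sub_nsmul_le hA hAA 2 0
  rw [zero_nsmul, sub_zero, two_nsmul] at h2
  unfold IsDilateControlled at *
  rw [neg_smul_finset, ← sub_eq_add_neg]
  refine le_of_mul_le_mul_right (h'.trans ?_) hA0
  calc _ ≤ (L ^ (2 + 0) * #A) * (L * #A) := by gcongr
    _ = _ := by ring

/-- Ruzsa covering places `x • A` and `y • A` in at most `L` translates each of `A - A`.
Plünnecke–Ruzsa then bounds `3 • A - 2 • A`, giving the exponent `2 + 5 = 7`. -/
theorem add (hA : A.Nonempty) (hAA : (#(A - A) : ℝ) ≤ L * #A) (hL : 1 ≤ L)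
    (hx : IsDilateControlled A L x)
    (hy : IsDilateControlled A L y) : IsDilateControlled A (L ^ 7) (x + y) := by
  have hA0 : (0 : ℝ) < #A := by exact_mod_cast hA.card_pos
  unfold IsDilateControlled at hx hy
  rw [add_comm] at hx hy
  obtain ⟨U, -, hU, hxU⟩ := ruzsa_covering_add hA hx
  obtain ⟨V, -, hV, hyV⟩ := ruzsa_covering_add hA hy
  have hsub : A + (x + y) • A ⊆ (U + V) + (3 • A - 2 • A) := by
    calc A + (x + y) • A ⊆ A + (x • A + y • A) := by
          refine add_subset_add_left fun z hz => ?_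
          obtain ⟨a, ha, rfl⟩ := mem_smul_finset.1 hz
          rw [add_smul]
          exact add_mem_add (smul_mem_smul_finset ha) (smul_mem_smul_finset ha)
      _ ⊆ A + ((U + (A - A)) + (V + (A - A))) := by gcongr
      _ = _ := by
        rw [show 3 • A = A + A + A by rw [succ_nsmul, two_nsmul], two_nsmul, sub_eq_add_neg,
          sub_eq_add_neg, neg_add]
        ac_rfl
  have h3 := card_nsmul_sub_nsmul_le hA hAA 3 2
  have h4 : (#(A + (x + y) • A) : ℝ) ≤ (#U * #V) * #(3 • A - 2 • A) := by
    exact_mod_cast (card_le_card hsub).trans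
      (card_add_le.trans (Nat.mul_le_mul_right _ card_add_le))
  refine h4.trans ?_
  calc _ ≤ (L * L) * (L ^ (3 + 2) * #A) := by gcongr
    _ = _ := by ring

theorem sub (hA : A.Nonempty) (hAA : (#(A - A) : ℝ) ≤ L * #A) (hL : 1 ≤ L)
    (hx : IsDilateControlled A L x)
    (hy : IsDilateControlled A L y) : IsDilateControlled A (L ^ 21) (x - y) := by
  have h3 : L ≤ L ^ 3 := le_self_pow₀ hL (by norm_num)
  rw [sub_eq_add_neg, show L ^ 21 = (L ^ 3) ^ 7 by ring]
  exact add hA (hAA.trans (by gcongr)) (one_le_pow₀ hL) (hx.mono h3) (neg hA hAA hL hy)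

end IsDilateControlled

/-! ### Energy of dilates and sum-product growth -/

/-- The equation is linear in `x`, so a quadruple has at most one solution unless both of its pairs
are diagonal. -/
theorem sum_card_dilate_quadruples_le {F : Type*} [Field F] [DecidableEq F] (A S : Finset F) :
    ∑ x ∈ S, #{q ∈ (A ×ˢ A) ×ˢ (A ×ˢ A) | q.1.1 + x * q.2.1 = q.1.2 + x * q.2.2}
      ≤ #S * #A ^ 2 + #A ^ 4 := by
  have h1 : ∑ x ∈ S, #{q ∈ (A ×ˢ A) ×ˢ (A ×ˢ A) | q.1.1 + x * q.2.1 = q.1.2 + x * q.2.2}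
      = ∑ q ∈ (A ×ˢ A) ×ˢ (A ×ˢ A), #{x ∈ S | q.1.1 + x * q.2.1 = q.1.2 + x * q.2.2} := by
    simp only [Finset.card_filter]
    rw [Finset.sum_comm]
  rw [h1]
  calc _ ≤ ∑ q ∈ (A ×ˢ A) ×ˢ (A ×ˢ A),
        ((if q.1.1 = q.1.2 ∧ q.2.1 = q.2.2 then #S else 0) + 1) := by
        refine Finset.sum_le_sum fun q _ => ?_
        by_cases h : q.2.1 = q.2.2
        · by_cases h' : q.1.1 = q.1.2
          · rw [if_pos ⟨h', h⟩]
            exact (card_filter_le _ _).trans (Nat.le_succ _)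
          · rw [h, filter_false_of_mem]
            · simp
            · intro x _ e
              exact h' (add_right_cancel e)
        · refine le_trans (card_le_one.2 fun x hx y hy => ?_) (Nat.le_add_left _ _)
          have hx := (mem_filter.1 hx).2
          have hy := (mem_filter.1 hy).2
          have : (x - y) * (q.2.1 - q.2.2) = 0 := by linear_combination hx - hy
          rcases mul_eq_zero.1 this with h0 | h0
          · exact sub_eq_zero.1 h0
          · exact absurd (sub_eq_zero.1 h0) h
    _ = _ := by
        rw [Finset.sum_add_distrib, Finset.sum_const, ← Finset.sum_filter, Finset.sum_const,
          filter_product (fun a : F × F => a.1 = a.2) (fun a : F × F => a.1 = a.2)]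
        have : #{a ∈ A ×ˢ A | a.1 = a.2} = #A := by
          rw [← diag_card A]
          congr 1
          ext ⟨a, b⟩
          simp only [mem_filter, mem_product, mem_diag]
          exact ⟨fun h => ⟨h.1.1, h.2⟩, fun h => ⟨⟨h.1, h.2 ▸ h.1⟩, h.2⟩⟩
        simp only [card_product, this, smul_eq_mul]
        ring

/-- Some `x` has at most the average energy of `A` and `x • A`, and Cauchy–Schwarz turns low energy
into a large sumset. -/
theorem exists_dilate_card_add_ge {F : Type*} [Field F] [DecidableEq F] (A S : Finset F)
    (hA : A.Nonempty) (hS : S.Nonempty) (h0 : (0 : F) ∉ S) :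
    ∃ x ∈ S, min ((#A : ℝ) ^ 2) #S ≤ 2 * #(A + x • A) := by
  have hA0 : (0 : ℝ) < #A := by exact_mod_cast hA.card_pos
  have hS0 : (0 : ℝ) < #S := by exact_mod_cast hS.card_pos
  obtain ⟨x, hx, hxE⟩ : ∃ x ∈ S,
      (#{q ∈ (A ×ˢ A) ×ˢ (A ×ˢ A) | q.1.1 + x * q.2.1 = q.1.2 + x * q.2.2} : ℝ)
        ≤ #A ^ 2 + #A ^ 4 / #S := by
    apply Finset.exists_le_of_sum_le hS
    rw [Finset.sum_const, nsmul_eq_mul]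
    have : (#S : ℝ) * (#A ^ 2 + #A ^ 4 / #S) = #S * #A ^ 2 + #A ^ 4 := by field_simp
    rw [this]
    exact_mod_cast sum_card_dilate_quadruples_le A S
  refine ⟨x, hx, ?_⟩
  have hx0 : x ≠ 0 := fun h => h0 (h ▸ hx)
  have hE : addEnergy A (x • A)
      ≤ #{q ∈ (A ×ˢ A) ×ˢ (A ×ˢ A) | q.1.1 + x * q.2.1 = q.1.2 + x * q.2.2} := by
    refine card_le_card_of_injOn (fun q => (q.1, (x⁻¹ * q.2.1, x⁻¹ * q.2.2))) ?_ ?_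
    · rintro ⟨⟨a, b⟩, c, d⟩ hq
      simp only [coe_filter, mem_product, Set.mem_ofPred_eq, mem_smul_finset, smul_eq_mul] at hq ⊢
      obtain ⟨⟨hab, ⟨c, hc, rfl⟩, ⟨d, hd, rfl⟩⟩, h⟩ := hq
      simp only [inv_mul_cancel_left₀ hx0]
      exact ⟨⟨hab, hc, hd⟩, h⟩
    · rintro ⟨⟨a, b⟩, c, d⟩ _ ⟨⟨a', b'⟩, c', d'⟩ _ h
      simpa [hx0] using h
  have hcs := le_card_add_mul_addEnergy A (x • A)
  rw [card_smul_finset₀ hx0] at hcs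
  have h1 : (#A : ℝ) ^ 2 * #A ^ 2 ≤ #(A + x • A) * (#A ^ 2 + #A ^ 4 / #S) := by
    have h2 : (#A : ℝ) ^ 2 * #A ^ 2 ≤ #(A + x • A) * addEnergy A (x • A) := by exact_mod_cast hcs
    have h3 : (addEnergy A (x • A) : ℝ) ≤ #A ^ 2 + #A ^ 4 / #S :=
      le_trans (by exact_mod_cast hE) hxE
    exact h2.trans (by gcongr)
  have h2 : (#A : ℝ) ^ 2 * #S ≤ #(A + x • A) * (#S + #A ^ 2) := by
    have e : (#A : ℝ) ^ 2 + #A ^ 4 / #S = #A ^ 2 / #S * (#S + #A ^ 2) := by field_simp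
    rw [e] at h1
    have h3 : (#A : ℝ) ^ 2 / #S * (#A ^ 2 * #S) ≤
        #A ^ 2 / #S * (#(A + x • A) * (#S + #A ^ 2)) := by
      calc _ = (#A : ℝ) ^ 2 * #A ^ 2 := by field_simp
        _ ≤ _ := h1
        _ = _ := by ring
    exact le_of_mul_le_mul_left h3 (by positivity)
  have hw : (0 : ℝ) ≤ #(A + x • A) := by positivity
  rcases le_total ((#A : ℝ) ^ 2) #S with h | h
  · rw [min_eq_left h]
    refine le_of_mul_le_mul_right ?_ hS0
    nlinarith
  · rw [min_eq_right h]
    refine le_of_mul_le_mul_left ?_ (pow_pos hA0 2)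
    nlinarith

theorem eq_top_of_forall_add_one_mem {p : ℕ} [Fact p.Prime] {Q : Set (ZMod p)} (h0 : 0 ∈ Q)
    (h : ∀ x ∈ Q, x + 1 ∈ Q) (x : ZMod p) : x ∈ Q := by
  have : ∀ n : ℕ, (n : ZMod p) ∈ Q := by
    intro n
    induction n with
    | zero => simpa using h0
    | succ n ih => rw [Nat.cast_succ]; exact h _ ih
  simpa using this x.val

/-- The quotient-set step: a set `X` in `𝔽_p` has a sum of two dilates, by combinations of
differences of `X`, of size at least about `min (#X ^ 2) p`. -/
theorem exists_large_sum_of_dilates {p : ℕ} [Fact p.Prime] (X : Finset (ZMod p))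
    (hX : X.Nontrivial) :
    ∃ a ∈ X, ∃ b ∈ X, ∃ c ∈ X, ∃ d ∈ X,
      min ((#X : ℝ) ^ 2) (p - 1) ≤ 2 * #((c - d) • X + (a - b) • X) ∨
      min ((#X : ℝ) ^ 2) (p - 1) ≤ 2 * #((c - d) • X + (a - b + (c - d)) • X) := by
  obtain ⟨u, hu, v, hv, huv⟩ := hX
  let Q : Set (ZMod p) := {x | ∃ a ∈ X, ∃ b ∈ X, ∃ c ∈ X, ∃ d ∈ X, c - d ≠ 0 ∧ x * (c - d) = a - b}
  have h0 : (0 : ZMod p) ∈ Q := ⟨u, hu, u, hu, u, hu, v, hv, sub_ne_zero.2 huv, by ring⟩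
  -- `Q` is the set of quotients of differences. If it is closed under `+ 1` it is all of `𝔽_p`, so
  -- the good dilate found by averaging is itself a quotient.
  by_cases hQ : ∀ x ∈ Q, x + 1 ∈ Q
  · have hS : ((univ : Finset (ZMod p)).erase 0).Nonempty := ⟨1, by simp⟩
    obtain ⟨x, -, hx⟩ := exists_dilate_card_add_ge X (univ.erase 0) ⟨u, hu⟩ hS (by simp)
    rw [card_erase_of_mem (mem_univ _), card_univ, ZMod.card,
      Nat.cast_sub (Fact.out : p.Prime).one_le, Nat.cast_one] at hx
    obtain ⟨a, ha, b, hb, c, hc, d, hd, hcd, e⟩ := eq_top_of_forall_add_one_mem h0 hQ x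
    refine ⟨a, ha, b, hb, c, hc, d, hd, Or.inl ?_⟩
    rwa [← e, mul_comm x, mul_smul, ← smul_add (c - d) X (x • X), card_smul_finset₀ hcd]
  · push Not at hQ
    obtain ⟨x, ⟨a, ha, b, hb, c, hc, d, hd, hcd, e⟩, hx⟩ := hQ
    refine ⟨a, ha, b, hb, c, hc, d, hd, Or.inr ?_⟩
    -- Two representations of one value of `y + (x + 1) * z` would make `x + 1` a quotient, so this
    -- map is injective on `X ×ˢ X`; scaling by `c - d` clears denominators.
    have hcard : #X ^ 2 ≤ #((c - d) • X + (a - b + (c - d)) • X) := by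
      rw [sq, ← card_product]
      refine card_le_card_of_injOn
        (fun q => (c - d) * q.1 + (a - b + (c - d)) * q.2) ?_ ?_
      · intro q hq
        have hq := mem_product.1 (mem_coe.1 hq)
        exact mem_coe.2 (add_mem_add (smul_mem_smul_finset hq.1) (smul_mem_smul_finset hq.2))
      · rintro ⟨y, z⟩ hq ⟨y', z'⟩ hq' h
        have hq := mem_product.1 (mem_coe.1 hq)
        have hq' := mem_product.1 (mem_coe.1 hq')
        simp only at hq hq' h
        have h1 : (c - d) * ((x + 1) * (z' - z) - (y - y')) = 0 := by
          linear_combination (z' - z) * e - h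
        have h2 := (mul_eq_zero.1 h1).resolve_left hcd
        have hz : z' = z := by
          by_contra hz
          exact hx ⟨y, hq.1, y', hq'.1, z', hq'.2, z, hq.2, sub_ne_zero.2 hz, sub_eq_zero.1 h2⟩
        subst hz
        have : y = y' := by linear_combination -h2
        rw [this]
    refine (min_le_left _ _).trans ?_
    have h : (#X : ℝ) ^ 2 ≤ #((c - d) • X + (a - b + (c - d)) • X) := by exact_mod_cast hcard
    linarith

theorem IsDilateControlled.of_mem_sum_of_dilates {F : Type*} [Field F] [DecidableEq F]
    {A X : Finset F} {L : ℝ} {x e f : F} (hA : A.Nonempty)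
    (hAA : (#(A - A) : ℝ) ≤ L * #A) (hL : 1 ≤ L) (hX : ∀ x ∈ X, IsDilateControlled A L x)
    (he : IsDilateControlled A L e) (hf : IsDilateControlled A L f)
    (hx : x ∈ e • X + f • X) : IsDilateControlled A (L ^ 14) x := by
  obtain ⟨y, hy, z, hz, rfl⟩ := mem_add.1 hx
  obtain ⟨y, hy', rfl⟩ := mem_smul_finset.1 hy
  obtain ⟨z, hz', rfl⟩ := mem_smul_finset.1 hz
  rw [show L ^ 14 = (L ^ 2) ^ 7 by ring]
  have h2 : L ≤ L ^ 2 := le_self_pow₀ hL (by norm_num)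
  exact add hA (hAA.trans (by gcongr)) (one_le_pow₀ hL) (mul hA hL he (hX y hy'))
    (mul hA hL hf (hX z hz'))

theorem exists_controlled_growth {p : ℕ} [Fact p.Prime] {A X : Finset (ZMod p)} {L : ℝ}
    (hA : A.Nonempty) (hAA : (#(A - A) : ℝ) ≤ L * #A) (hL : 1 ≤ L)
    (hX : ∀ x ∈ X, IsDilateControlled A L x) :
    ∃ Y : Finset (ZMod p), (∀ x ∈ Y, IsDilateControlled A (L ^ 2058) x) ∧
      min ((#X : ℝ) ^ 2) (p - 1) ≤ 2 * #Y := by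
  have hmono : ∀ k : ℕ, k ≠ 0 → L ≤ L ^ k := fun k hk => le_self_pow₀ hL hk
  rcases (X : Set (ZMod p)).subsingleton_or_nontrivial with h | h
  · refine ⟨X, fun x hx => (hX x hx).mono (hmono _ (by norm_num)), (min_le_left _ _).trans ?_⟩
    have h1 : (#X : ℝ) ≤ 1 := by
      exact_mod_cast card_le_one.2 fun a ha b hb => h (mem_coe.2 ha) (mem_coe.2 hb)
    have h0 : (0 : ℝ) ≤ #X := by positivity
    nlinarith
  obtain ⟨a, ha, b, hb, c, hc, d, hd, hY⟩ := exists_large_sum_of_dilates X h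
  have hab := IsDilateControlled.sub hA hAA hL (hX a ha) (hX b hb)
  have hcd := IsDilateControlled.sub hA hAA hL (hX c hc) (hX d hd)
  have hsum := IsDilateControlled.add hA
    (hAA.trans (by gcongr; exact hmono 21 (by norm_num))) (one_le_pow₀ hL) hab hcd
  have h147 : L ^ 21 ≤ (L ^ 21) ^ 7 := le_self_pow₀ (one_le_pow₀ hL) (by norm_num)
  have hL147 : L ≤ (L ^ 21) ^ 7 := by rw [← pow_mul]; exact hmono _ (by norm_num)
  have key : ∀ f : ZMod p, IsDilateControlled A ((L ^ 21) ^ 7) f →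
      ∀ x ∈ (c - d) • X + f • X, IsDilateControlled A (L ^ 2058) x := by
    intro f hf x hx
    -- `2058 = 21 * 7 * 14`: the costs of a difference, of a sum of two differences, and of a sum of
    -- two products.
    rw [show L ^ 2058 = ((L ^ 21) ^ 7) ^ 14 by rw [← pow_mul, ← pow_mul]]
    exact IsDilateControlled.of_mem_sum_of_dilates hA (hAA.trans (by gcongr))
      (one_le_pow₀ (one_le_pow₀ hL)) (fun x hx => (hX x hx).mono hL147) (hcd.mono h147) hf hx
  rcases hY with hY | hY
  · exact ⟨_, key _ (hab.mono h147), hY⟩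
  · exact ⟨_, key _ hsum, hY⟩

/-- Half the cardinality is the natural quantity: one growth step at least squares it, until the cap
`p - 1` intervenes. -/
theorem exists_controlled_growth_iterate {p : ℕ} [Fact p.Prime] {A X : Finset (ZMod p)} {L : ℝ}
    (hA : A.Nonempty) (hAA : (#(A - A) : ℝ) ≤ L * #A) (hL : 1 ≤ L) (hp : 5 ≤ p)
    (hX : ∀ x ∈ X, IsDilateControlled A L x) (n : ℕ) :
    ∃ Y : Finset (ZMod p), (∀ x ∈ Y, IsDilateControlled A (L ^ 2058 ^ n) x) ∧
      min (4 * ((#X : ℝ) / 2) ^ 2 ^ n) ((p : ℝ) - 1) ≤ 2 * (#Y : ℝ) := by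
  have hp' : (5 : ℝ) ≤ p := by exact_mod_cast hp
  induction n with
  | zero =>
    refine ⟨X, by simpa using hX, (min_le_left _ _).trans (le_of_eq ?_)⟩
    rw [pow_zero, pow_one]; ring
  | succ n ih =>
    obtain ⟨Y, hY, hcard⟩ := ih
    obtain ⟨Z, hZ, hcard'⟩ := exists_controlled_growth hA
      (hAA.trans (by gcongr; exact le_self_pow₀ hL (by positivity))) (one_le_pow₀ hL) hY
    refine ⟨Z, by simpa only [← pow_mul, ← pow_succ] using hZ, le_trans (le_min ?_ ?_) hcard'⟩
    · rcases min_le_iff.1 hcard with h | h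
      · refine (min_le_left _ _).trans ?_
        have e : 4 * ((#X : ℝ) / 2) ^ 2 ^ (n + 1) = (2 * ((#X : ℝ) / 2) ^ 2 ^ n) ^ 2 := by
          rw [mul_pow, ← pow_mul, ← pow_succ]; norm_num
        rw [e]
        gcongr
        linarith
      · refine (min_le_right _ _).trans ?_
        -- Once at the cap, one stays there: `2 * #Y ≥ p - 1 ≥ 4` gives `#Y ^ 2 ≥ 2 * #Y ≥ p - 1`.
        nlinarith
    · exact min_le_right _ _

theorem card_le_or_le_card_of_controlled {p : ℕ} [Fact p.Prime] {A X : Finset (ZMod p)} {L : ℝ}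
    (hA : A.Nonempty) (hAA : (#(A - A) : ℝ) ≤ L * #A) (hL : 1 ≤ L) (hp : 6 ≤ p)
    (hX : ∀ x ∈ X, IsDilateControlled A L x) (n : ℕ) (hn : (p : ℝ) ≤ ((#X : ℝ) / 2) ^ 2 ^ n) :
    (#A : ℝ) ≤ 2 * L ^ 2058 ^ n ∨ (p : ℝ) ≤ 8 * L ^ 2058 ^ n * #A := by
  have hp' : (6 : ℝ) ≤ p := by exact_mod_cast hp
  have hA0 : (0 : ℝ) < #A := by exact_mod_cast hA.card_pos
  obtain ⟨Y, hY, hcard⟩ := exists_controlled_growth_iterate hA hAA hL (by omega) hX n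
  rw [min_eq_right (by linarith)] at hcard
  have hS : (p : ℝ) / 4 ≤ #(Y.erase 0) := by
    have h1 : #Y ≤ #(Y.erase 0) + 1 := by
      have := pred_card_le_card_erase (s := Y) (a := 0)
      omega
    have h2 : (#Y : ℝ) ≤ #(Y.erase 0) + 1 := by exact_mod_cast h1
    linarith
  have hS0 : (Y.erase 0).Nonempty := by
    rw [← card_pos, ← Nat.cast_pos (α := ℝ)]
    linarith
  obtain ⟨x, hx, h⟩ := exists_dilate_card_add_ge A (Y.erase 0) hA hS0 (by simp)
  have hc : (#(A + x • A) : ℝ) ≤ L ^ 2058 ^ n * #A := hY x (mem_of_mem_erase hx)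
  rcases min_le_iff.1 h with h | h
  · left
    refine le_of_mul_le_mul_right ?_ hA0
    linarith
  · right
    linarith

/-! ### From overlapping dilates to the size dichotomy -/

theorem card_sq_le_card_mul_sum_inter {ι F : Type*} [DecidableEq F] (H : Finset ι)
    (B : ι → Finset F) (D : Finset F) (hBD : ∀ h ∈ H, B h ⊆ D) :
    (∑ h ∈ H, (#(B h) : ℝ)) ^ 2 ≤ #D * ∑ h' ∈ H, ∑ h ∈ H, (#(B h ∩ B h') : ℝ) := by
  have h1 : ∀ h ∈ H, (#(B h) : ℝ) = ∑ x ∈ D, if x ∈ B h then (1 : ℝ) else 0 := by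
    intro h hh
    rw [Finset.sum_ite_mem, inter_eq_right.2 (hBD h hh), sum_const, nsmul_eq_mul, mul_one]
  have h2 : ∀ h' ∈ H, ∀ h ∈ H, (#(B h ∩ B h') : ℝ)
      = ∑ x ∈ D, (if x ∈ B h then (1 : ℝ) else 0) * if x ∈ B h' then (1 : ℝ) else 0 := by
    intro h' _ h hh
    simp only [ite_zero_mul_ite_zero, mul_one, ← mem_inter]
    rw [Finset.sum_ite_mem, inter_eq_right.2 (inter_subset_left.trans (hBD h hh)), sum_const,
      nsmul_eq_mul, mul_one]
  rw [sum_congr rfl h1, sum_comm, sum_congr rfl fun h' hh' => sum_congr rfl (h2 h' hh')]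
  refine sq_sum_le_card_mul_sum_sq.trans (le_of_eq ?_)
  congr 1
  simp_rw [sq, Finset.sum_mul_sum]
  rw [sum_comm]
  refine (sum_congr rfl fun h _ => sum_comm).trans ?_
  rw [sum_comm]

/-- The dilates `h • B` crowd into `D`, so by Cauchy–Schwarz one fixed `h' • B` meets many of them
substantially. The ratios `h / h'` are controlled, by Ruzsa's triangle inequality through `x • B ∩
B`. -/
theorem exists_many_controlled {F : Type*} [Field F] [DecidableEq F] {B D H : Finset F} {K : ℝ}
    (hK : 1 ≤ K) (hB : B.Nonempty) (hH : H.Nonempty) (hH0 : (0 : F) ∉ H)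
    (hBB : (#(B - B) : ℝ) ≤ K * #B) (hD : (#D : ℝ) ≤ K * #B) (hHB : ∀ h ∈ H, h • B ⊆ D) :
    ∃ X : Finset F, (#H : ℝ) / (2 * K) ≤ #X ∧ ∀ x ∈ X, IsDilateControlled B (2 * K ^ 5) x := by
  have hK0 : 0 < K := by linarith
  have hB0 : (0 : ℝ) < #B := by exact_mod_cast hB.card_pos
  have hH0' : (0 : ℝ) < #H := by exact_mod_cast hH.card_pos
  have hne : ∀ h ∈ H, h ≠ 0 := fun h hh e => hH0 (e ▸ hh)
  have hcs := card_sq_le_card_mul_sum_inter H (fun h => h • B) D hHB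
  rw [sum_congr rfl fun h hh => by rw [card_smul_finset₀ (hne h hh)], sum_const,
    nsmul_eq_mul] at hcs
  obtain ⟨h', hh', hsum⟩ : ∃ h' ∈ H, (#H : ℝ) * #B / K ≤ ∑ h ∈ H, (#(h • B ∩ h' • B) : ℝ) := by
    apply Finset.exists_le_of_sum_le hH
    rw [sum_const, nsmul_eq_mul]
    have h0 : (0 : ℝ) ≤ ∑ h' ∈ H, ∑ h ∈ H, (#(h • B ∩ h' • B) : ℝ) := by positivity
    have h1 := hcs.trans (mul_le_mul_of_nonneg_right hD h0)
    have h2 : (#H : ℝ) * #B * (#H * #B / K) ≤ #B * ∑ h' ∈ H, ∑ h ∈ H, (#(h • B ∩ h' • B) : ℝ) := by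
      rw [mul_div_assoc', div_le_iff₀ hK0]
      linarith
    refine le_of_mul_le_mul_left ?_ hB0
    linarith
  set H' : Finset F := {h ∈ H | (#B : ℝ) / (2 * K) ≤ #(h • B ∩ h' • B)} with hH'
  have hcard : (#H : ℝ) / (2 * K) ≤ #H' := by
    have h1 : ∑ h ∈ H, (#(h • B ∩ h' • B) : ℝ)
        ≤ ∑ h ∈ H, ((if (#B : ℝ) / (2 * K) ≤ #(h • B ∩ h' • B) then (#B : ℝ) else 0)
          + #B / (2 * K)) := by
      refine sum_le_sum fun h hh => ?_
      split_ifs with hc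
      · have : (#(h • B ∩ h' • B) : ℝ) ≤ #B := by
          rw [← card_smul_finset₀ (s := B) (hne h hh)]
          exact_mod_cast card_le_card inter_subset_left
        have : 0 ≤ (#B : ℝ) / (2 * K) := by positivity
        linarith
      · rw [zero_add]
        exact (not_le.1 hc).le
    rw [sum_add_distrib, sum_const, ← sum_filter, sum_const, nsmul_eq_mul, nsmul_eq_mul,
      ← hH'] at h1
    have h2 := hsum.trans h1
    have e : (#H : ℝ) * #B / K = #H / (2 * K) * #B + #H * (#B / (2 * K)) := by field_simp; norm_num
    rw [e] at h2
    exact le_of_mul_le_mul_right (by linarith) hB0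
  have hh'0 := hne h' hh'
  refine ⟨h'⁻¹ • H', by rwa [card_smul_finset₀ (inv_ne_zero hh'0)], fun x hx => ?_⟩
  obtain ⟨h, hh, rfl⟩ := mem_smul_finset.1 hx
  obtain ⟨hhH, hinter⟩ := mem_filter.1 hh
  set x := h'⁻¹ • h with hxdef
  have hx0 : x ≠ 0 := mul_ne_zero (inv_ne_zero hh'0) (hne h hhH)
  have hxB : (#B : ℝ) / (2 * K) ≤ #(x • B ∩ B) := by
    have e : h' • (x • B ∩ B) = h • B ∩ h' • B := by
      rw [smul_finset_inter₀ hh'0, ← mul_smul, hxdef, smul_eq_mul, mul_inv_cancel_left₀ hh'0]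
    rwa [← card_smul_finset₀ (s := x • B ∩ B) hh'0, e]
  have h2B : (#(B + B) : ℝ) ≤ K ^ 2 * #B := by
    simpa [two_nsmul] using IsDilateControlled.card_nsmul_sub_nsmul_le hB hBB 2 0
  have htri := ruzsa_triangle_inequality_add_add_add B (x • B ∩ B) (x • B)
  have h1 : #(B + (x • B ∩ B)) ≤ #(B + B) := card_le_card (add_subset_add_left inter_subset_right)
  have h2 : #((x • B ∩ B) + x • B) ≤ #(B + B) := by
    rw [← card_smul_finset₀ (s := B + B) hx0, smul_add x B B]
    exact card_le_card (add_subset_add_right inter_subset_left)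
  have h3 : (#(B + x • B) : ℝ) * #(x • B ∩ B) ≤ #(B + B) * #(B + B) := by
    exact_mod_cast htri.trans (Nat.mul_le_mul h1 h2)
  have h4 : (#(B + x • B) : ℝ) * (#B / (2 * K)) ≤ (K ^ 2 * #B) * (K ^ 2 * #B) := by
    calc _ ≤ (#(B + x • B) : ℝ) * #(x • B ∩ B) := by gcongr
      _ ≤ _ := h3
      _ ≤ _ := by gcongr
  unfold IsDilateControlled
  rw [mul_div_assoc', div_le_iff₀ (by positivity)] at h4
  refine le_of_mul_le_mul_right ?_ hB0
  calc _ ≤ _ := h4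
    _ = _ := by ring

/-- A set `A` of `𝔽_p` with many differences in a set `D` of comparable size, such that `D` contains
all dilates of `A` by elements of a large set `H`, is either very small or very large. -/
theorem card_le_or_le_card_of_smul_subset {p : ℕ} [Fact p.Prime] {A D H : Finset (ZMod p)} {K : ℝ}
    (hp : 6 ≤ p) (hK : 2 ≤ K) (hA : A.Nonempty) (hD : (#D : ℝ) ≤ K * #A)
    (hE : (#A : ℝ) ^ 2 / K ≤ #{x ∈ A ×ˢ A | x.1 - x.2 ∈ D})
    (hH : H.Nonempty) (hH0 : (0 : ZMod p) ∉ H) (hHA : ∀ h ∈ H, h • A ⊆ D)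
    (n : ℕ) (hn : (p : ℝ) ≤ ((#H : ℝ) / K ^ 24) ^ 2 ^ n) :
    (#A : ℝ) ≤ K ^ (111 * 2058 ^ n + 4) ∨ (p : ℝ) ≤ K ^ (111 * 2058 ^ n + 3) * #A := by
  have hK1 : 1 ≤ K := by linarith
  have hA0 : (0 : ℝ) < #A := by exact_mod_cast hA.card_pos
  -- Since `K ≥ 2`, every numerical constant can be absorbed into a power of `K`.
  have two_pow_mul : ∀ a b : ℕ, 2 ^ a * K ^ b ≤ K ^ (a + b) := by
    intro a b
    rw [pow_add]
    gcongr
  obtain ⟨B, hBA, hB, hBB⟩ := balog_szemeredi_gowers A D hK1 hA hD hE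
  have hB0 : (0 : ℝ) < #B := lt_of_lt_of_le (by positivity) hB
  have hB1 : B.Nonempty := by rw [← card_pos]; exact_mod_cast hB0
  have hAB : (#A : ℝ) ≤ 4 * K * #B := by
    rw [div_le_iff₀ (by positivity)] at hB; linarith
  have h22 : 4096 * K ^ 10 ≤ K ^ 22 := by
    have := two_pow_mul 12 10
    norm_num at this ⊢
    exact this
  have h4 : K * (4 * K) ≤ K ^ 22 := by
    have h := two_pow_mul 2 2
    have h' : K ^ (2 + 2) ≤ K ^ 22 := pow_le_pow_right₀ hK1 (by norm_num)
    norm_num at h h'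
    linarith
  obtain ⟨X, hX, hXc⟩ := exists_many_controlled (D := D) (H := H) (K := K ^ 22) (one_le_pow₀ hK1)
    hB1 hH hH0 (hBB.trans (by gcongr))
    (hD.trans (by
      calc K * #A ≤ K * (4 * K * #B) := by gcongr
        _ = K * (4 * K) * #B := by ring
        _ ≤ _ := by gcongr))
    (fun h hh => (smul_finset_subset_smul_finset hBA).trans (hHA h hh))
  have hL : 2 * (K ^ 22) ^ 5 ≤ K ^ 111 := by
    have := two_pow_mul 1 110
    rw [← pow_mul]
    norm_num at this ⊢
    exact this
  have hXn : (p : ℝ) ≤ ((#X : ℝ) / 2) ^ 2 ^ n := by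
    refine hn.trans (pow_le_pow_left₀ (by positivity) ?_ _)
    have h := two_pow_mul 2 22
    norm_num at h
    calc (#H : ℝ) / K ^ 24 ≤ #H / (4 * K ^ 22) := by gcongr
      _ = (#H : ℝ) / (2 * K ^ 22) / 2 := by field_simp; norm_num
      _ ≤ _ := div_le_div_of_nonneg_right hX zero_le_two
  have hpow : (K ^ 111) ^ 2058 ^ n = K ^ (111 * 2058 ^ n) := by rw [← pow_mul]
  rcases card_le_or_le_card_of_controlled hB1
    (hBB.trans (mul_le_mul_of_nonneg_right (h22.trans (pow_le_pow_right₀ hK1 (by norm_num)))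
      hB0.le) : (#(B - B) : ℝ) ≤ K ^ 111 * #B) (one_le_pow₀ hK1) hp
    (fun x hx => (hXc x hx).mono hL) n hXn with h | h
  · left
    rw [hpow] at h
    calc (#A : ℝ) ≤ 4 * K * (2 * K ^ (111 * 2058 ^ n)) := hAB.trans (by gcongr)
      _ = 2 ^ 3 * K ^ (111 * 2058 ^ n + 1) := by rw [pow_succ]; ring
      _ ≤ K ^ (3 + (111 * 2058 ^ n + 1)) := two_pow_mul _ _
      _ = _ := by congr 1; ring
  · right
    rw [hpow] at h
    have hBA' : (#B : ℝ) ≤ #A := by exact_mod_cast card_le_card hBA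
    calc (p : ℝ) ≤ 2 ^ 3 * K ^ (111 * 2058 ^ n) * #A := h.trans (by gcongr; norm_num)
      _ ≤ K ^ (3 + 111 * 2058 ^ n) * #A := by gcongr; exact two_pow_mul _ _
      _ = _ := by rw [add_comm]

/-! ### Large spectrum -/

/-- The exponential sum `∑ x ∈ H, ψ (a * x)`. -/
noncomputable def dilateSum {F : Type*} [Field F] (ψ : AddChar F ℂ) (H : Finset F) (a : F) : ℂ :=
  ∑ x ∈ H, ψ (a * x)

/-- The set of frequencies at which the normalized exponential sum over `H` is at least `τ`. -/
noncomputable def largeSpectrum {F : Type*} [Field F] [Fintype F] (ψ : AddChar F ℂ)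
    (H : Finset F) (τ : ℝ) : Finset F :=
  {a | τ * #H ≤ ‖dilateSum ψ H a‖}

section spectrum
variable {F : Type*} [Field F] [Fintype F] {ψ : AddChar F ℂ} {H : Finset F}

theorem mem_largeSpectrum {τ : ℝ} {a : F} :
    a ∈ largeSpectrum ψ H τ ↔ τ * #H ≤ ‖dilateSum ψ H a‖ := by
  simp [largeSpectrum]

theorem norm_dilateSum_le (ψ : AddChar F ℂ) (H : Finset F) (a : F) :
    ‖dilateSum ψ H a‖ ≤ #H := by
  refine (norm_sum_le _ _).trans (le_of_eq ?_)
  simp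

/-- Parseval, from orthogonality of the characters. -/
theorem sum_norm_dilateSum_sq [DecidableEq F] (hψ : ψ ≠ 1) :
    ∑ a, ‖dilateSum ψ H a‖ ^ 2 = Fintype.card F * #H := by
  have h : ∑ a, ((‖dilateSum ψ H a‖ ^ 2 : ℝ) : ℂ) = Fintype.card F * #H := by
    calc ∑ a, ((‖dilateSum ψ H a‖ ^ 2 : ℝ) : ℂ)
        = ∑ a, ∑ x ∈ H, ∑ y ∈ H, ψ (a * (x - y)) := by
          refine sum_congr rfl fun a _ => ?_
          rw [Complex.ofReal_pow, ← Complex.mul_conj', dilateSum, map_sum, sum_mul_sum]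
          refine sum_congr rfl fun x _ => sum_congr rfl fun y _ => ?_
          rw [← AddChar.map_neg_eq_conj, ← AddChar.map_add_eq_mul]
          congr 1; ring
      _ = ∑ x ∈ H, ∑ y ∈ H, ∑ a, ψ (a * (x - y)) := by
          rw [sum_comm]
          exact sum_congr rfl fun x _ => sum_comm
      _ = ∑ x ∈ H, ∑ y ∈ H, if x = y then (Fintype.card F : ℂ) else 0 := by
          refine sum_congr rfl fun x _ => sum_congr rfl fun y _ => ?_
          rw [AddChar.sum_mulShift _ (AddChar.IsPrimitive.of_ne_one hψ)]
          simp only [sub_eq_zero]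
          split_ifs <;> simp
      _ = _ := by
          rw [sum_congr rfl fun x hx => by rw [sum_ite_eq, if_pos hx], sum_const, nsmul_eq_mul,
            mul_comm]
  exact_mod_cast h

theorem card_largeSpectrum_mul_le [DecidableEq F] (hψ : ψ ≠ 1) (hH : H.Nonempty) {τ : ℝ}
    (hτ : 0 ≤ τ) : (#(largeSpectrum ψ H τ) : ℝ) * (τ ^ 2 * #H) ≤ Fintype.card F := by
  have hH0 : (0 : ℝ) < #H := by exact_mod_cast hH.card_pos
  have h : ∑ a ∈ largeSpectrum ψ H τ, (τ * #H) ^ 2 ≤ ∑ a, ‖dilateSum ψ H a‖ ^ 2 :=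
    (sum_le_sum fun a ha => by have := mem_largeSpectrum.1 ha; gcongr).trans
      (sum_le_sum_of_subset_of_nonneg (subset_univ _) fun _ _ _ => by positivity)
  rw [sum_norm_dilateSum_sq hψ, sum_const, nsmul_eq_mul] at h
  refine le_of_mul_le_mul_right ?_ hH0
  linarith

/-- Remove the phases of the sums with unimodular (or zero) weights `c a`, exchange summations, and
apply Cauchy–Schwarz over `H`; expanding the square produces the sums at `a - b`. -/
theorem card_sq_mul_le_sum_norm_dilateSum_sub (A : Finset F) (hH : H.Nonempty) {τ : ℝ} (hτ : 0 ≤ τ)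
    (hA : A ⊆ largeSpectrum ψ H τ) :
    τ ^ 2 * #H * (#A : ℝ) ^ 2 ≤ ∑ a ∈ A, ∑ b ∈ A, ‖dilateSum ψ H (a - b)‖ := by
  have hH0 : (0 : ℝ) < #H := by exact_mod_cast hH.card_pos
  let c : F → ℂ := fun a => conj (dilateSum ψ H a) / ‖dilateSum ψ H a‖
  have hc : ∀ a, ‖c a‖ ≤ 1 := by
    intro a
    simp only [c, norm_div, RCLike.norm_conj, Complex.norm_real, norm_norm]
    exact div_self_le_one _
  have hcS : ∀ a, c a * dilateSum ψ H a = ‖dilateSum ψ H a‖ := by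
    intro a
    by_cases h : dilateSum ψ H a = 0
    · simp [h]
    · have : (‖dilateSum ψ H a‖ : ℂ) ≠ 0 := by simpa using h
      simp only [c]
      rw [div_mul_eq_mul_div, mul_comm, Complex.mul_conj', div_eq_iff this, sq]
  let G : F → ℂ := fun x => ∑ a ∈ A, c a * ψ (a * x)
  have h1 : τ * #H * #A ≤ ∑ x ∈ H, ‖G x‖ := by
    have e : ((∑ a ∈ A, ‖dilateSum ψ H a‖ : ℝ) : ℂ) = ∑ x ∈ H, G x := by
      rw [Complex.ofReal_sum, sum_comm]
      refine sum_congr rfl fun a _ => ?_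
      rw [← hcS, dilateSum, mul_sum]
    calc τ * #H * #A = ∑ a ∈ A, τ * #H := by rw [sum_const, nsmul_eq_mul]; ring
      _ ≤ ∑ a ∈ A, ‖dilateSum ψ H a‖ := sum_le_sum fun a ha => mem_largeSpectrum.1 (hA ha)
      _ = ‖((∑ a ∈ A, ‖dilateSum ψ H a‖ : ℝ) : ℂ)‖ := by
          rw [Complex.norm_real, Real.norm_of_nonneg (by positivity)]
      _ ≤ _ := by rw [e]; exact norm_sum_le _ _
  have h2 : (τ * #H * #A) ^ 2 ≤ #H * ∑ x ∈ H, ‖G x‖ ^ 2 :=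
    (pow_le_pow_left₀ (by positivity) h1 2).trans sq_sum_le_card_mul_sum_sq
  have h3 : ∑ x ∈ H, ‖G x‖ ^ 2 ≤ ∑ a ∈ A, ∑ b ∈ A, ‖dilateSum ψ H (a - b)‖ := by
    have e : ((∑ x ∈ H, ‖G x‖ ^ 2 : ℝ) : ℂ)
        = ∑ a ∈ A, ∑ b ∈ A, c a * conj (c b) * dilateSum ψ H (a - b) := by
      rw [Complex.ofReal_sum]
      calc _ = ∑ x ∈ H, ∑ a ∈ A, ∑ b ∈ A, c a * conj (c b) * ψ ((a - b) * x) := by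
            refine sum_congr rfl fun x _ => ?_
            rw [Complex.ofReal_pow, ← Complex.mul_conj', map_sum, sum_mul_sum]
            refine sum_congr rfl fun a _ => sum_congr rfl fun b _ => ?_
            rw [map_mul (starRingEnd ℂ) (c b), ← AddChar.map_neg_eq_conj, mul_mul_mul_comm,
              ← AddChar.map_add_eq_mul]
            congr 2; ring
        _ = _ := by
            rw [sum_comm]
            refine sum_congr rfl fun a _ => ?_
            rw [sum_comm]
            refine sum_congr rfl fun b _ => ?_
            rw [dilateSum, mul_sum]
    calc ∑ x ∈ H, ‖G x‖ ^ 2 = ‖((∑ x ∈ H, ‖G x‖ ^ 2 : ℝ) : ℂ)‖ := by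
          rw [Complex.norm_real, Real.norm_of_nonneg (by positivity)]
      _ ≤ _ := by
          rw [e]
          refine (norm_sum_le _ _).trans (sum_le_sum fun a _ => (norm_sum_le _ _).trans
            (sum_le_sum fun b _ => ?_))
          rw [norm_mul, norm_mul, RCLike.norm_conj]
          refine mul_le_of_le_one_left (norm_nonneg _) ?_
          exact mul_le_one₀ (hc a) (norm_nonneg _) (hc b)
  refine le_of_mul_le_mul_left ?_ hH0
  calc (#H : ℝ) * (τ ^ 2 * #H * (#A : ℝ) ^ 2) = (τ * #H * #A) ^ 2 := by ring
    _ ≤ _ := h2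
    _ ≤ _ := by gcongr

theorem card_sq_mul_le_card_sub_mem_largeSpectrum [DecidableEq F] (A : Finset F) (hH : H.Nonempty)
    {τ : ℝ} (hτ : 0 ≤ τ) (hA : A ⊆ largeSpectrum ψ H τ) :
    τ ^ 2 / 2 * (#A : ℝ) ^ 2 ≤ #{x ∈ A ×ˢ A | x.1 - x.2 ∈ largeSpectrum ψ H (τ ^ 2 / 2)} := by
  have hH0 : (0 : ℝ) < #H := by exact_mod_cast hH.card_pos
  have h := card_sq_mul_le_sum_norm_dilateSum_sub A hH hτ hA
  rw [← sum_product' A A (fun a b => ‖dilateSum ψ H (a - b)‖)] at h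
  have h2 : ∑ x ∈ A ×ˢ A, ‖dilateSum ψ H (x.1 - x.2)‖ ≤ ∑ x ∈ A ×ˢ A,
      ((if x.1 - x.2 ∈ largeSpectrum ψ H (τ ^ 2 / 2) then (#H : ℝ) else 0) + τ ^ 2 / 2 * #H) := by
    refine sum_le_sum fun x _ => ?_
    split_ifs with hx
    · have := norm_dilateSum_le ψ H (x.1 - x.2)
      have : 0 ≤ τ ^ 2 / 2 * (#H : ℝ) := by positivity
      linarith
    · rw [mem_largeSpectrum, not_le] at hx
      linarith
  rw [sum_add_distrib, sum_const, ← sum_filter, sum_const, nsmul_eq_mul, nsmul_eq_mul,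
    card_product] at h2
  push_cast at h2
  refine le_of_mul_le_mul_right ?_ hH0
  linarith

end spectrum

/-! ### Segments of powers and near-invariance of their spectrum -/

section powerSegment
variable {p : ℕ} {g : (ZMod p)ˣ} {T : ℕ}

theorem powerSegment_injOn (hT : T ≤ orderOf g) :
    Set.InjOn (fun t : ℕ => (g : ZMod p) ^ t) (Finset.range T) := by
  intro s hs t ht h
  have hs := mem_range.1 (mem_coe.1 hs)
  have ht := mem_range.1 (mem_coe.1 ht)
  refine pow_injOn_Iio_orderOf (x := g) (Set.mem_Iio.2 (hs.trans_le hT))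
    (Set.mem_Iio.2 (ht.trans_le hT)) ?_
  ext
  simpa using h

theorem card_powerSegment (hT : T ≤ orderOf g) : #(powerSegment g T) = T := by
  rw [powerSegment, card_image_of_injOn (powerSegment_injOn hT), card_range]

theorem zero_notMem_powerSegment [Fact p.Prime] : (0 : ZMod p) ∉ powerSegment g T := by
  simp [powerSegment]

/-- The factor `g ^ s` shifts the exponent window by `s`, which changes at most `s` unimodular terms
at each end. -/
theorem norm_dilateSum_powerSegment_sub_le [Fact p.Prime] (ψ : AddChar (ZMod p) ℂ)
    (hT : T ≤ orderOf g) (a : ZMod p) (s : ℕ) :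
    ‖dilateSum ψ (powerSegment g T) a‖ - 2 * s
      ≤ ‖dilateSum ψ (powerSegment g T) (g ^ s * a)‖ := by
  have e : ∀ b, dilateSum ψ (powerSegment g T) b = ∑ t ∈ Finset.range T, ψ (b * g ^ t) := fun b => by
    rw [dilateSum, powerSegment, sum_image (powerSegment_injOn hT)]
  set f : ℕ → ℂ := fun t => ψ (a * g ^ t) with hf
  have hb : ∀ (k : ℕ), ‖∑ t ∈ Finset.range s, f (k + t)‖ ≤ s := fun k =>
    (norm_sum_le _ _).trans (le_of_eq (by simp [f]))
  have e1 : dilateSum ψ (powerSegment g T) (g ^ s * a) = ∑ t ∈ Finset.range T, f (s + t) := by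
    rw [e]
    refine sum_congr rfl fun t _ => ?_
    simp only [f]
    congr 1; ring
  have h1 := sum_range_add f T s
  rw [add_comm T s, sum_range_add f s T] at h1
  have h2 : dilateSum ψ (powerSegment g T) a = dilateSum ψ (powerSegment g T) (g ^ s * a)
      + (∑ t ∈ Finset.range s, f (0 + t) - ∑ t ∈ Finset.range s, f (T + t)) := by
    rw [e1, e a]
    simp only [zero_add]
    linear_combination -h1
  have h3 := norm_add_le (dilateSum ψ (powerSegment g T) (g ^ s * a))
    (∑ t ∈ Finset.range s, f (0 + t) - ∑ t ∈ Finset.range s, f (T + t))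
  rw [← h2] at h3
  have h4 := norm_sub_le (∑ t ∈ Finset.range s, f (0 + t)) (∑ t ∈ Finset.range s, f (T + t))
  linarith [hb 0, hb T]

end powerSegment

/-! ### Choice of level and conclusion -/

theorem exists_succ_le_mul_of_le_pow {K P : ℝ} (hK : 0 ≤ K) {J : ℕ} (hJ : P ≤ K ^ J)
    (N : ℕ → ℝ) (h0 : 1 ≤ N 0) (hN : N J ≤ P) (hJ0 : J ≠ 0) : ∃ j < J, N (j + 1) ≤ K * N j := by
  by_contra! h
  have key : ∀ j ≤ J, K ^ j ≤ N j ∧ (j ≠ 0 → K ^ j < N j) := by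
    intro j
    induction j with
    | zero => simpa using h0
    | succ j ih =>
      intro hj
      have h1 := (ih (by omega)).1
      have h2 := h j (by omega)
      have h3 : K ^ (j + 1) < N (j + 1) := by
        rw [pow_succ']
        exact (mul_le_mul_of_nonneg_left h1 hK).trans_lt h2
      exact ⟨h3.le, fun _ => h3⟩
  exact absurd ((key J le_rfl).2 hJ0) (not_lt.2 (hN.trans hJ))

/-- The exponential sum over `T > K ^ M` consecutive powers of `g` is at most `τ 0 * T`, for any
sequence of levels `τ (j + 1) = τ j ^ 2 / 2` staying above `2 / K` for as long as it takes
`K ^ j` to reach `p`. -/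
theorem norm_dilateSum_powerSegment_le {p : ℕ} [Fact p.Prime] {g : (ZMod p)ˣ} {T : ℕ} {K : ℝ}
    {M n J : ℕ} (hK : 2 ≤ K) (hT : T ≤ orderOf g) (hM : 111 * 2058 ^ n + 100 ≤ M)
    (hMT : K ^ M < T) (hn : (p : ℝ) ≤ (K ^ (M - 28)) ^ 2 ^ n) (hJ0 : J ≠ 0)
    (hJ : (p : ℝ) ≤ K ^ J) (τ : ℕ → ℝ) (hτ : ∀ j, τ (j + 1) = τ j ^ 2 / 2)
    (hτJ : ∀ j ≤ J, 2 / K ≤ τ j)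
    {ψ : AddChar (ZMod p) ℂ} (hψ : ψ ≠ 1) :
    ‖dilateSum ψ (powerSegment g T) 1‖ ≤ τ 0 * T := by
  by_contra! hlarge
  have hK1 : 1 ≤ K := by linarith
  have hK0 : 0 < K := by linarith
  have hT0 : (0 : ℝ) < T := lt_trans (by positivity) hMT
  have hcard : #(powerSegment g T) = T := card_powerSegment hT
  have hne : (powerSegment g T).Nonempty := by
    rw [← card_pos, hcard]; exact_mod_cast hT0
  have hTp : T ≤ p := by
    have h := card_le_univ (powerSegment g T)
    rwa [hcard, ZMod.card] at h
  have hp : 6 ≤ p := by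
    have h1 : (2 : ℝ) ^ 3 ≤ K ^ M :=
      (pow_le_pow_left₀ zero_le_two hK 3).trans (pow_le_pow_right₀ hK1 (by omega))
    have h2 : (6 : ℝ) < T := by norm_num at h1; linarith
    have h3 : 6 < T := by exact_mod_cast h2
    omega
  have hp0 : (0 : ℝ) < p := by positivity
  have hK2 : 4 ≤ K ^ 2 := by nlinarith
  have hτ1 : ∀ j ≤ J, τ j ≤ 1 := by
    intro j
    induction j with
    | zero =>
      intro _
      have h := norm_dilateSum_le ψ (powerSegment g T) 1
      rw [hcard] at h
      exact (le_of_mul_le_mul_right (by linarith) hT0)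
    | succ j ih =>
      intro hj
      have h1 := ih (by omega)
      have h2 : 0 < τ j := lt_of_lt_of_le (by positivity) (hτJ j (by omega))
      rw [hτ]
      nlinarith
  let Λ : ℕ → Finset (ZMod p) := fun j => largeSpectrum ψ (powerSegment g T) (τ j)
  -- As `τ j ≤ 1`, the drop `τ j - τ j ^ 2 / 2` is at least `τ j / 2 ≥ 1 / K`. This leaves room for
  -- the loss `2 * s ≤ 2 * T / K ^ 3` of a shift.
  have hsucc : ∀ j < J, τ (j + 1) ≤ τ j - 2 / K ^ 3 := by
    intro j hj
    have h1 := hτ1 j hj.le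
    have h2 := hτJ j hj.le
    have h3 : 2 / K ^ 3 ≤ 1 / K := by
      rw [div_le_div_iff₀ (by positivity) hK0]
      nlinarith
    have h4 : 2 / K = 2 * (1 / K) := by ring
    have h5 : 0 < 1 / K := by positivity
    rw [hτ]
    nlinarith
  have hmem : ∀ j < J, ∀ s : ℕ, (s : ℝ) ≤ T / K ^ 3 → ∀ a ∈ Λ j,
      (g : ZMod p) ^ s * a ∈ Λ (j + 1) := by
    intro j hj s hs a ha
    rw [mem_largeSpectrum, hcard] at ha ⊢
    refine le_trans ?_ (norm_dilateSum_powerSegment_sub_le ψ hT a s)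
    have h1 := mul_le_mul_of_nonneg_right (hsucc j hj) hT0.le
    have h2 : (τ j - 2 / K ^ 3) * T = τ j * T - 2 * (T / K ^ 3) := by ring
    linarith
  have hone : ∀ j ≤ J, (1 : ZMod p) ∈ Λ j := by
    intro j
    induction j with
    | zero =>
      intro _
      rw [mem_largeSpectrum, hcard]
      exact hlarge.le
    | succ j ih =>
      intro hj
      have := hmem j (by omega) 0 (by push_cast; positivity) 1 (ih (by omega))
      simpa using this
  obtain ⟨j, hj, hcardΛ⟩ := exists_succ_le_mul_of_le_pow hK0.le hJ (fun j => (#(Λ j) : ℝ))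
    (by exact_mod_cast card_pos.2 ⟨1, hone 0 (Nat.zero_le _)⟩)
    (by
      have h := card_le_univ (Λ J)
      rw [ZMod.card] at h
      exact_mod_cast h) hJ0
  set m := ⌊(T : ℝ) / K ^ 3⌋₊ with hm
  have hmle : (m : ℝ) ≤ T / K ^ 3 := Nat.floor_le (by positivity)
  have hmge : K ^ (M - 4) ≤ m := by
    have h1 : (T : ℝ) / K ^ 3 < m + 1 := Nat.lt_floor_add_one _
    have h2 : K ^ (M - 3) < T / K ^ 3 := by
      rw [lt_div_iff₀ (by positivity), ← pow_add, show M - 3 + 3 = M by omega]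
      exact hMT
    have h3 : K ^ (M - 3) = K * K ^ (M - 4) := by
      rw [← pow_succ']; congr 1; omega
    have h4 : 1 ≤ K ^ (M - 4) := one_le_pow₀ hK1
    nlinarith
  have hmT : m ≤ T := by
    have : (m : ℝ) ≤ T := hmle.trans (div_le_self hT0.le (one_le_pow₀ hK1))
    exact_mod_cast this
  have hcardm : #(powerSegment g m) = m := card_powerSegment (hmT.trans hT)
  have hm0 : (0 : ℝ) < m := lt_of_lt_of_le (by positivity) hmge
  have hsmul : ∀ h ∈ powerSegment g m, h • Λ j ⊆ Λ (j + 1) := by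
    intro h hh x hx
    obtain ⟨s, hs, rfl⟩ := mem_image.1 hh
    obtain ⟨a, ha, rfl⟩ := mem_smul_finset.1 hx
    have hs : (s : ℝ) ≤ m := by exact_mod_cast (mem_range.1 hs).le
    exact hmem j hj s (hs.trans hmle) a ha
  have hE : (#(Λ j) : ℝ) ^ 2 / K ≤ #{x ∈ Λ j ×ˢ Λ j | x.1 - x.2 ∈ Λ (j + 1)} := by
    have h1 := card_sq_mul_le_card_sub_mem_largeSpectrum (Λ j) hne
      (τ := τ j) (le_trans (by positivity) (hτJ j hj.le)) subset_rfl
    rw [← hτ] at h1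
    have h2 : 1 / K ≤ τ (j + 1) := le_trans (by gcongr; norm_num) (hτJ (j + 1) hj)
    calc (#(Λ j) : ℝ) ^ 2 / K = 1 / K * (#(Λ j) : ℝ) ^ 2 := by ring
      _ ≤ τ (j + 1) * (#(Λ j) : ℝ) ^ 2 := by gcongr
      _ ≤ _ := h1
  have hmΛ : (m : ℝ) ≤ K * #(Λ j) := by
    refine le_trans ?_ hcardΛ
    have hsub : powerSegment g m ⊆ Λ (j + 1) := by
      intro x hx
      have h1 := hsmul x hx (smul_mem_smul_finset (a := x) (hone j hj.le))
      rwa [smul_eq_mul, mul_one] at h1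
    have h := card_le_card hsub
    rw [hcardm] at h
    exact_mod_cast h
  have hn' : (p : ℝ) ≤ ((#(powerSegment g m) : ℝ) / K ^ 24) ^ 2 ^ n := by
    refine hn.trans (pow_le_pow_left₀ (by positivity) ?_ _)
    rw [hcardm, le_div_iff₀ (by positivity), ← pow_add, show M - 28 + 24 = M - 4 by omega]
    exact hmge
  rcases card_le_or_le_card_of_smul_subset hp hK ⟨1, hone j hj.le⟩ hcardΛ hE
    (card_pos.1 (by rw [hcardm]; exact_mod_cast hm0)) zero_notMem_powerSegment hsmul n hn' with h | h
  -- Tiny case: `1 ∈ Λ j`, so `Λ (j + 1)` contains all `m ≥ K ^ (M - 4)` powers, too many for `K *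
  -- #(Λ j)`.
  · have h1 : K ^ (M - 4) ≤ K ^ (111 * 2058 ^ n + 5) := by
      calc K ^ (M - 4) ≤ K * #(Λ j) := hmge.trans hmΛ
        _ ≤ K * K ^ (111 * 2058 ^ n + 4) := by gcongr
        _ = _ := by rw [← pow_succ']
    have h2 : K ^ (111 * 2058 ^ n + 5) < K ^ (M - 4) :=
      pow_lt_pow_right₀ (by linarith) (by omega)
    linarith
  -- Nearly full case: Parseval forces `T` below a power of `K` smaller than `K ^ M`.
  · have h1 : (#(Λ j) : ℝ) * (τ j ^ 2 * T) ≤ p := by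
      have h := card_largeSpectrum_mul_le hψ hne (τ := τ j)
        (le_trans (by positivity) (hτJ j hj.le))
      rwa [hcard, ZMod.card] at h
    have h2 : 1 / K ≤ τ j ^ 2 := by
      have h3 : 2 / K ≤ τ (j + 1) := hτJ (j + 1) hj
      have h4 : 1 / K ≤ 2 / K := by gcongr; norm_num
      rw [hτ] at h3
      have := sq_nonneg (τ j)
      linarith
    have hΛ0 : (0 : ℝ) < #(Λ j) := by
      exact_mod_cast card_pos.2 ⟨1, hone j hj.le⟩
    have h5 : (#(Λ j) : ℝ) * K ^ M < #(Λ j) * K ^ (111 * 2058 ^ n + 4) := by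
      calc (#(Λ j) : ℝ) * K ^ M < #(Λ j) * T := by gcongr
        _ = #(Λ j) * (1 / K * T) * K := by field_simp
        _ ≤ #(Λ j) * (τ j ^ 2 * T) * K := by gcongr
        _ ≤ p * K := by gcongr
        _ ≤ K ^ (111 * 2058 ^ n + 3) * #(Λ j) * K := by gcongr
        _ = _ := by ring
    have h6 : K ^ (111 * 2058 ^ n + 4) ≤ K ^ M := pow_le_pow_right₀ hK1 (by omega)
    exact absurd h5 (not_lt.2 (by gcongr))

end

theorem mainTheorem3 (α : ℝ) (hα : 0 < α) :
    ∃ β : ℝ, 0 < β ∧ ∃ C : ℝ, 0 < C ∧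
      ∀ (p : ℕ) [Fact p.Prime] (g : (ZMod p)ˣ) (T : ℕ),
        T ≤ orderOf g → (p : ℝ) ^ α < (T : ℝ) →
        ∀ ψ : AddChar (ZMod p) ℂ, ψ ≠ 1 →
          ‖∑ x ∈ powerSegment g T, ψ x‖ ≤
            C * (p : ℝ) ^ (-β) * ((powerSegment g T).card : ℝ) := by
  -- With `2 ^ n > 2 / α`, `n` squarings take `K ^ (M - 28) ≥ p ^ (α / 2)` beyond `p`; `J > M / α`
  -- makes `K ^ J ≥ p`.
  obtain ⟨n, hn⟩ := pow_unbounded_of_one_lt (2 / α) one_lt_two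
  obtain ⟨M, hM⟩ : ∃ M : ℕ, M = 111 * 2058 ^ n + 100 := ⟨_, rfl⟩
  have hM0 : (0 : ℝ) < M := by
    have : 0 < M := by omega
    exact_mod_cast this
  obtain ⟨J, hJ⟩ := exists_nat_gt (M / α)
  have hJpos : (0 : ℝ) < J := lt_trans (by positivity) hJ
  have hJ0 : J ≠ 0 := by
    rintro rfl
    simp at hJpos
  set ε : ℝ := α / M with hε
  have hε0 : 0 < ε := by positivity
  refine ⟨ε / 2 ^ J, by positivity, 2, two_pos, ?_⟩
  intro p hp g T hT hpT ψ hψ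
  have hp1 : (1 : ℝ) ≤ p := by exact_mod_cast hp.out.one_le
  have hp0 : (0 : ℝ) < p := by linarith
  have hS : ∑ x ∈ powerSegment g T, ψ x = dilateSum ψ (powerSegment g T) 1 := by
    simp [dilateSum]
  rw [hS]
  set K : ℝ := (p : ℝ) ^ ε with hKdef
  have hKpow : ∀ k : ℕ, K ^ k = (p : ℝ) ^ (ε * k) := fun k => by
    rw [Real.rpow_mul hp0.le, Real.rpow_natCast]
  rcases lt_or_ge K 2 with hK | hK
  -- For `K < 2` the claimed bound is weaker than the trivial one; this is where `C = 2` is used.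
  · have h1 : 1 ≤ 2 * (p : ℝ) ^ (-(ε / 2 ^ J)) := by
      rw [Real.rpow_neg hp0.le, ← div_eq_mul_inv, le_div_iff₀ (by positivity), one_mul]
      refine le_trans (Real.rpow_le_rpow_of_exponent_le hp1 ?_) hK.le
      exact div_le_self hε0.le (one_le_pow₀ one_le_two)
    exact (norm_dilateSum_le ψ _ 1).trans (le_mul_of_one_le_left (by positivity) h1)
  · rw [card_powerSegment hT]
    have h := norm_dilateSum_powerSegment_le (J := J) (n := n) (M := M) hK hT hM.ge ?_ ?_ hJ0 ?_
      -- Explicit solution of the recursion for `τ`, ending exactly at `τ J = 2 / K`; this fixes `β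
      -- = ε / 2 ^ J`.
      (fun j => 2 * (p : ℝ) ^ (-(ε / 2 ^ J * 2 ^ j))) ?_ ?_ hψ
    · simpa using h
    · rw [hKpow, hε, div_mul_cancel₀ _ hM0.ne']
      exact hpT
    · rw [← pow_mul, hKpow]
      refine le_trans (Real.rpow_one _).ge (Real.rpow_le_rpow_of_exponent_le hp1 ?_)
      have h28 : (M : ℝ) / 2 ≤ ((M - 28 : ℕ) : ℝ) := by
        rw [Nat.cast_sub (by omega)]
        have : (100 : ℝ) ≤ M := by exact_mod_cast (by omega : 100 ≤ M)
        push_cast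
        linarith
      push_cast
      calc (1 : ℝ) = ε * (M / 2 * (2 / α)) := by rw [hε]; field_simp
        _ ≤ ε * (((M - 28 : ℕ) : ℝ) * 2 ^ n) := by gcongr
    · rw [hKpow]
      refine le_trans (Real.rpow_one _).ge (Real.rpow_le_rpow_of_exponent_le hp1 ?_)
      calc (1 : ℝ) = ε * (M / α) := by rw [hε]; field_simp
        _ ≤ ε * J := by gcongr
    · intro j
      have : ((p : ℝ) ^ (-(ε / 2 ^ J * 2 ^ j))) ^ 2 = (p : ℝ) ^ (-(ε / 2 ^ J * 2 ^ (j + 1))) := by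
        rw [← Real.rpow_natCast, ← Real.rpow_mul hp0.le]
        congr 1
        push_cast
        ring
      rw [mul_pow, this]
      ring
    · intro j hj
      rw [Real.rpow_neg hp0.le, ← div_eq_mul_inv]
      refine div_le_div_of_nonneg_left zero_le_two (by positivity) ?_
      refine Real.rpow_le_rpow_of_exponent_le hp1 ?_
      calc ε / 2 ^ J * 2 ^ j ≤ ε / 2 ^ J * 2 ^ J := by gcongr; norm_num
        _ = ε := by field_simp
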